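/- **Setting.** Let $D=1\{P\ge V\}$ be a binary treatment, $Y=DY_1+(1-D)Y_0$ the observed outcome, and $X=(X^C,X^D)$ covariates with $X^C\in\mathbb R^c$ ($c\ge1$) continuously and $X^D\in\mathbb R^e$ discretely distributed, $P(X^D=0)>0$. Here $V$ is the reduced-form treatment error, uniform on $[0,1]$ and independent of $X$, and $P=\pi(X)$ with $\pi(x)=E[D\mid X=x]\in[0,1]$ the propensity score, taken continuous in $x^C$ on the support of $X$ for every fixed $x^D$. A point $(x^C,x^D)$ is in the support of $X$ if $x^D$ is an atom of $X^D$ and $x^C$ is in the support of $X^C$ given $X^D=x^D$. Put $\pi_0(x^C)=\pi(x^C,0)$ and let $\mathcal S_0$ be the support of $X^C$ given $X^D=0$. The potential outcomes are $Y_d=l(X'\gamma_d,V_d)$, $d=0,1$, with a known measurable link $l:\mathbb R^2\to\mathbb R$, real errors $V_d$ and unknown $\gamma_d=(\gamma_d^C,\gamma_d^D)$; $Y_d$ and $l(t,V_d)$, $t\in\mathbb R$, are integrable. For $t\in\mathbb R$, $p\in[0,1]$ let $$r_0(t,p)=\int_p^1E[l(t,V_0)\mid V=v]\,dv,\qquad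 r_1(t,p)=\int_0^pE[l(t,V_1)\mid V=v]\,dv .$$ **Assumptions**, for $d=0,1$: - (A.CI) $V_d$ is independent of $X$ conditional on $V$. - (A.N) $\gamma_{d,1}^C=1$. - (A.NL) $\pi_0$ is differentiable on $\mathcal S_0$; $r_d$ is continuous on $\mathbb R\times[0,1]$ and differentiable on $\mathbb R\times(0,1)$; and there are $x,\tilde x\in\mathcal S_0$, at which derivatives are determined by values on $\mathcal S_0$ (e.g. interior points), and $k,j\in\{1,\dots,c\}$ such that (i) $\partial_1r_d(x'\gamma_d^C,\pi_0(x))\ne0$; (ii) $\partial_1r_d(\tilde x'\gamma_d^C,\pi_0(\tilde x))\neq0$; (iii) $\partial_k\pi_0(x)\ne\partial_1\pi_0(x)\gamma^C_{d,k}$; (iv) $\partial_j\pi_0(x)\ne\partial_1\pi_0(x)\gamma^C_{d,j}$; (v) $\partial_i\pi_0(\tilde x)\ne\partial_1\pi_0(\tilde x)\gamma^C_{d,i}$ for $i=2,\dots,c$; (vi) $$\begin{aligned}&\partial_k\pi_0(x)\partial_j\pi_0(\tilde x)-\partial_k\pi_0(\tilde x)\partial_j\pi_0(x)\\&\quad\neq[\partial_1\pi_0(x)\partial_j\pi_0(\tilde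 x)-\partial_1\pi_0(\tilde x)\partial_j\pi_0(x)]\gamma^C_{d,k}-[\partial_1\pi_0(x)\partial_k\pi_0(\tilde x)-\partial_1\pi_0(\tilde x)\partial_k\pi_0(x)]\gamma^C_{d,j}.\end{aligned}$$ - (A.S) For each $k\le e$ there are $a\ne0$ and $x^C$ such that, with $x^{Dk}$ the vector with $k$-th entry $a$ and all others $0$, $(x^C,x^{Dk})$ is in the support of $X$ and the pair $\bigl(x^{C\prime}\gamma_d^C+a\gamma_{d,k}^D,\ \pi(x^C,x^{Dk})\bigr)$ is in the support of $\bigl(X^{C\prime}\gamma_d^C,\pi_0(X^C)\bigr)$ given $X^D=0$. - (A.I) For every $x$ in the support of $X$, $t\mapsto r_d(t,\pi(x))$ is injective. **Theorem A.5.** Under these assumptions $\gamma_d$ and $r_d(t,p)$, at all points $(t,p)$ of the support of $(X'\gamma_d,P)$, are identified for $d=0,1$: if two such structures with the same link $l$ generate the same joint law of $(Y,D,X)$, then they have the same $\gamma_0,\gamma_1$, the same supports of $(X'\gamma_d,P)$, and their functions $r_d$ agree there. Moreover the marginal treatment effect satisfies, almost surely, $$E[Y_1-Y_0\mid X,V]=\partial_2r_1(X'\gamma_1,V)+\partial_2r_0(X'\gamma_0,V),$$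 and $\partial_2r_1(x'\gamma_1,v)+\partial_2r_0(x'\gamma_0,v)$ is the same for two such structures at every $x$ and $v\in(0,1)$ such that, for $d=0,1$, $v$ is an accumulation point of $\{p:(x'\gamma_d,p)\text{ is in the support of }(X'\gamma_d,P)\}$. -/

import Mathlib

open MeasureTheory ProbabilityTheory Set

noncomputable section

namespace LimitedOutcome

/-- A structure (data-generating process) of the linear latent index model with a binary treatment.
`c` and `e` are the numbers of continuous and discrete covariates; the potential outcome in
treatment state `d : Fin 2` has the error term `err d` and the coefficients `(γC d, γD d)`.
`V` is the error of the treatment equation `D = 1{P ≥ V}` in reduced form, `P = pscore X`. -/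
structure Model (c e : ℕ) (Ω : Type*) [MeasurableSpace Ω] where
  μ : Measure Ω
  [isProb : IsProbabilityMeasure μ]
  XC : Ω → Fin c → ℝ
  XD : Ω → Fin e → ℝ
  V : Ω → ℝ
  err : Fin 2 → Ω → ℝ
  pscore : (Fin c → ℝ) → (Fin e → ℝ) → ℝ
  γC : Fin 2 → Fin c → ℝ
  γD : Fin 2 → Fin e → ℝ
  measurable_XC : Measurable XC
  measurable_XD : Measurable XD
  measurable_V : Measurable V
  measurable_err : ∀ d, Measurable (err d)
  measurable_pscore : Measurable (Function.uncurry pscore)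

attribute [instance] Model.isProb

namespace Model

variable {c e : ℕ} {Ω : Type*} [MeasurableSpace Ω]

/-- All covariates `X = (X^C, X^D)`. -/
def X (S : Model c e Ω) (ω : Ω) : (Fin c → ℝ) × (Fin e → ℝ) := (S.XC ω, S.XD ω)

/-- The linear index `x'γ_d`. -/
def index (S : Model c e Ω) (d : Fin 2) (xc : Fin c → ℝ) (xd : Fin e → ℝ) : ℝ :=
  (∑ i, xc i * S.γC d i) + ∑ i, xd i * S.γD d i

/-- The potential outcome `Y_d = l(X'γ_d, V_d)`. -/
def Ypot (S : Model c e Ω) (l : ℝ → ℝ → ℝ) (d : Fin 2) (ω : Ω) : ℝ :=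
  l (S.index d (S.XC ω) (S.XD ω)) (S.err d ω)

/-- The treatment `D = 1{P ≥ V}`. -/
def D (S : Model c e Ω) : Ω → ℝ :=
  {ω | S.V ω ≤ S.pscore (S.XC ω) (S.XD ω)}.indicator 1

/-- The observed outcome `Y = D Y_1 + (1 - D) Y_0`. -/
def Y (S : Model c e Ω) (l : ℝ → ℝ → ℝ) (ω : Ω) : ℝ :=
  S.D ω * S.Ypot l 1 ω + (1 - S.D ω) * S.Ypot l 0 ω

/-- The joint law of the observables `(Y, D, X)`. -/
def obsLaw (S : Model c e Ω) (l : ℝ → ℝ → ℝ) :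
    Measure (ℝ × ℝ × (Fin c → ℝ) × (Fin e → ℝ)) :=
  S.μ.map (fun ω => (S.Y l ω, S.D ω, S.X ω))

/-- The support of `X^C` given `X^D = xd`; empty unless `xd` is an atom of the law of `X^D`.
Thus `(xc, xd)` lies in the support of `X` iff `xc ∈ S.suppAt xd`. -/
def suppAt (S : Model c e Ω) (xd : Fin e → ℝ) : Set (Fin c → ℝ) :=
  ((S.μ.restrict (S.XD ⁻¹' {xd})).map S.XC).support

/-- `π_0(x^C) = π(x^C, 0)`. -/
def pscore₀ (S : Model c e Ω) (xc : Fin c → ℝ) : ℝ := S.pscore xc 0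

/-- The partial derivative `∂_k π_0`, taken within the support of `X^C` given `X^D = 0`. -/
def dpscore₀ (S : Model c e Ω) (k : Fin c) (xc : Fin c → ℝ) : ℝ :=
  fderivWithin ℝ S.pscore₀ (S.suppAt 0) xc (Pi.single k 1)

/-- `E[l(t, V_d) | V = v]`. -/
def condMean (S : Model c e Ω) (l : ℝ → ℝ → ℝ) (d : Fin 2) (t v : ℝ) : ℝ :=
  ∫ y, l t y ∂(condDistrib (S.err d) S.V S.μ v)

/-- `r_0(t,p) = ∫_p^1 E[l(t,V_0) | V=v] dv` and `r_1(t,p) = ∫_0^p E[l(t,V_1) | V=v] dv`. -/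
def r (S : Model c e Ω) (l : ℝ → ℝ → ℝ) : Fin 2 → ℝ → ℝ → ℝ :=
  ![fun t p => ∫ v in p..1, S.condMean l 0 t v, fun t p => ∫ v in (0 : ℝ)..p, S.condMean l 1 t v]

/-- `∂_1 r_d (t, p)`. -/
def d1r (S : Model c e Ω) (l : ℝ → ℝ → ℝ) (d : Fin 2) (t p : ℝ) : ℝ :=
  deriv (fun s => S.r l d s p) t

/-- `∂_2 r_d (t, p)`. -/
def d2r (S : Model c e Ω) (l : ℝ → ℝ → ℝ) (d : Fin 2) (t p : ℝ) : ℝ :=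
  deriv (fun q => S.r l d t q) p

/-- The support of `(X'γ_d, P)`. -/
def indexSupp (S : Model c e Ω) (d : Fin 2) : Set (ℝ × ℝ) :=
  (S.μ.map fun ω =>
    (S.index d (S.XC ω) (S.XD ω), S.pscore (S.XC ω) (S.XD ω))).support

/-- The support of `(X^C'γ_d^C, π_0(X^C))` given `X^D = 0`. -/
def indexSupp₀ (S : Model c e Ω) (d : Fin 2) : Set (ℝ × ℝ) :=
  ((S.μ.restrict (S.XD ⁻¹' {0})).map fun ω =>
    (∑ i, S.XC ω i * S.γC d i, S.pscore₀ (S.XC ω))).support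

/-- The standing conventions: `X^C` is continuously and `X^D` discretely distributed, `0` is in the
support of `X^D`, the reduced-form treatment error `V` is standard uniform and independent of `X`
(hence `π(X) = E[D | X]`), the propensity score is a `[0,1]`-valued version of this conditional
probability that is continuous in `x^C` on the support, and the expectations that occur exist. -/
structure Standing (S : Model c e Ω) (l : ℝ → ℝ → ℝ) : Prop where
  continuous_XC : ∀ k a, S.μ {ω | S.XC ω k = a} = 0
  discrete_XD : ∃ A : Set (Fin e → ℝ), A.Countable ∧ ∀ᵐ ω ∂S.μ, S.XD ω ∈ A
  zero_mem : S.μ (S.XD ⁻¹' {0}) ≠ 0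
  uniform_V : S.μ.map S.V = volume.restrict (Icc 0 1)
  indep_V : IndepFun S.V S.X S.μ
  pscore_mem : ∀ xc xd, S.pscore xc xd ∈ Icc (0 : ℝ) 1
  pscore_cont : ∀ xd, ContinuousOn (fun xc => S.pscore xc xd) (S.suppAt xd)
  integrable_Y : ∀ d, Integrable (S.Ypot l d) S.μ
  integrable_l : ∀ d t, Integrable (fun ω => l t (S.err d ω)) S.μ

/-- Conditional independence: `V_d ⊥ X | V`. -/
def CondIndep [StandardBorelSpace Ω] (S : Model c e Ω) (d : Fin 2) : Prop :=
  CondIndepFun (MeasurableSpace.comap S.V inferInstance) S.measurable_V.comap_le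
    (S.err d) S.X S.μ

/-- Normalization: the first continuous covariate has coefficient one. -/
def Normalized [NeZero c] (S : Model c e Ω) (d : Fin 2) : Prop := S.γC d 0 = 1

/-- Differentiability of `π_0` and `r_d`. The function `r_d` lives on `ℝ × [0,1]`; it is only asked
to be continuous there and differentiable on `ℝ × (0,1)`. -/
structure Smooth (S : Model c e Ω) (l : ℝ → ℝ → ℝ) (d : Fin 2) : Prop where
  pscore₀_diff : DifferentiableOn ℝ S.pscore₀ (S.suppAt 0)
  r_cont : ContinuousOn (Function.uncurry (S.r l d)) (univ ×ˢ Icc 0 1)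
  r_diff : DifferentiableOn ℝ (Function.uncurry (S.r l d)) (univ ×ˢ Ioo 0 1)

/-- Non-linearity. The two points are points of the support at which the derivatives are determined
by the values on the support (such as all its interior points). -/
def NonLinear [NeZero c] (S : Model c e Ω) (l : ℝ → ℝ → ℝ) (d : Fin 2) : Prop :=
  S.Smooth l d ∧
  ∃ x ∈ S.suppAt 0, ∃ x' ∈ S.suppAt 0,
    UniqueDiffWithinAt ℝ (S.suppAt 0) x ∧ UniqueDiffWithinAt ℝ (S.suppAt 0) x' ∧
    ∃ k j : Fin c,
      S.d1r l d (∑ i, x i * S.γC d i) (S.pscore₀ x) ≠ 0 ∧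
      S.d1r l d (∑ i, x' i * S.γC d i) (S.pscore₀ x') ≠ 0 ∧
      S.dpscore₀ k x ≠ S.dpscore₀ 0 x * S.γC d k ∧
      S.dpscore₀ j x ≠ S.dpscore₀ 0 x * S.γC d j ∧
      (∀ i : Fin c, i ≠ 0 → S.dpscore₀ i x' ≠ S.dpscore₀ 0 x' * S.γC d i) ∧
      S.dpscore₀ k x * S.dpscore₀ j x' - S.dpscore₀ k x' * S.dpscore₀ j x ≠
        (S.dpscore₀ 0 x * S.dpscore₀ j x' - S.dpscore₀ 0 x' * S.dpscore₀ j x) * S.γC d k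
        - (S.dpscore₀ 0 x * S.dpscore₀ k x' - S.dpscore₀ 0 x' * S.dpscore₀ k x) * S.γC d j

/-- Support: for each discrete covariate `k` there are a value `a ≠ 0` and a point
`(x^C, (0,…,a,…,0))` of the support of `X` whose index and propensity score, jointly, lie in the
support of `(X^C'γ_d^C, π_0(X^C))`. -/
def SupportCond (S : Model c e Ω) (d : Fin 2) : Prop :=
  ∀ k : Fin e, ∃ a : ℝ, a ≠ 0 ∧ ∃ xc ∈ S.suppAt (Pi.single k a),
    ((∑ i, xc i * S.γC d i) + a * S.γD d k, S.pscore xc (Pi.single k a)) ∈ S.indexSupp₀ d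

/-- Invertibility of `r_d` in its first argument, at the values that the propensity score takes on
the support of `X`. -/
def Invertible (S : Model c e Ω) (l : ℝ → ℝ → ℝ) (d : Fin 2) : Prop :=
  ∀ xd, ∀ xc ∈ S.suppAt xd, Function.Injective fun t => S.r l d t (S.pscore xc xd)

/-- All assumptions on a structure. -/
structure Admissible [NeZero c] [StandardBorelSpace Ω] (S : Model c e Ω) (l : ℝ → ℝ → ℝ) :
    Prop where
  standing : S.Standing l
  condIndep : ∀ d, S.CondIndep d
  normalized : ∀ d, S.Normalized d
  nonLinear : ∀ d, S.NonLinear l d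
  supportCond : ∀ d, S.SupportCond d
  invertible : ∀ d, S.Invertible l d

/-- The expression `∂₂r₁(x'γ₁, v) + ∂₂r₀(x'γ₀, v)`. -/
def mte (S : Model c e Ω) (l : ℝ → ℝ → ℝ) (xc : Fin c → ℝ) (xd : Fin e → ℝ) (v : ℝ) : ℝ :=
  S.d2r l 1 (S.index 1 xc xd) v + S.d2r l 0 (S.index 0 xc xd) v

/-- `∂₂r₁ + ∂₂r₀` is the marginal treatment effect `E[Y₁ - Y₀ | X, V]`. -/
def MTERepresentation (S : Model c e Ω) (l : ℝ → ℝ → ℝ) : Prop :=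
  S.μ[fun ω => S.Ypot l 1 ω - S.Ypot l 0 ω |
      MeasurableSpace.comap (fun ω => (S.X ω, S.V ω)) inferInstance]
    =ᵐ[S.μ] fun ω => S.mte l (S.XC ω) (S.XD ω) (S.V ω)

end Model

end LimitedOutcome

end

/-! Given `X = x`, the event `D = d` restricts `V` to an interval, and conditional independence
makes `E[Y_d | X, V]` equal to `E[l(t, V_d) | V]` at `t = x'γ_d`. As `V` is uniform and independent
of `X`, integration gives `E[Y 1{D = d} | X = x] = r_d(x'γ_d, π(x))` and `P(D = 1 | X = x) = π(x)`.
The left sides depend only on the law of `(Y, D, X)` (`Standing.setIntegral_r`,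
`Standing.setIntegral_pscore`), and continuity upgrades almost sure equality to equality on supports
(`eq_of_mem_support_map`).

At `X^D = 0` the gradient in `x^C` is `∂₁r_d γ + ∂₂r_d ∇π₀`. If two structures share it, the
normalization eliminates `∂₁r_d` of the first one and leaves `A₁ (γ - γ₁) = (B₁ - B) w`, where `w =
∇π₀ - ∂₁π₀ γ` and `A₁`, `B₁` belong to the second structure. With two points, either some `B₁ - B`
vanishes and `γ = γ₁`, or a 2 × 2 minor of the two vectors `w` vanishes, which (vi) forbids
(`coef_eq_of_gradient_eq`).

With `γ^C` known, `r_d` is known on the support of index and score given `X^D = 0`. Each point of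
the support condition carries a value of `r_d` there, and inverting it yields a coordinate of `γ^D`.
All indices are then common, so `r_d` agrees on the whole support. The treatment effect follows by
Lebesgue differentiation of `r_d` in `p`. -/

namespace LimitedOutcome

/-- Two functions that are continuous on a closed set and agree almost everywhere along a map `h`
with values in that set agree on the support of the law of `h`. -/
theorem eq_of_mem_support_map {α E F : Type*} [MeasurableSpace α] {μ : Measure α}
    [TopologicalSpace E] [MeasurableSpace E] [OpensMeasurableSpace E] [TopologicalSpace F]
    [T2Space F] {h : α → E} (hh : AEMeasurable h μ) {K : Set E} (hK : IsClosed K) {f g : E → F}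
    (hf : ContinuousOn f K) (hg : ContinuousOn g K)
    (hae : ∀ᵐ ω ∂μ, h ω ∈ K ∧ f (h ω) = g (h ω)) {z : E} (hz : z ∈ (μ.map h).support) :
    f z = g z := by
  -- A closed set of full measure contains the support. Continuity holds only on `K`, so the
  -- agreement set is closed because `K` is.
  have hcl : IsClosed {x | x ∈ K ∧ f x = g x} := by
    have : IsClosed (K ∩ (fun x => (f x, g x)) ⁻¹' {p : F × F | p.1 = p.2}) :=
      (hf.prodMk hg).preimage_isClosed_of_isClosed hK
        (isClosed_eq continuous_fst continuous_snd)
    exact this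
  have hmem : {x | x ∈ K ∧ f x = g x} ∈ ae (μ.map h) :=
    (ae_map_iff hh hcl.measurableSet).2 hae
  exact (Measure.support_subset_of_isClosed hcl hmem hz).2

namespace Model

/-! ### Measurability and the treatment state as an event in `(X, V)`. -/

variable {c e : ℕ} {Ω : Type*} [MeasurableSpace Ω] (S : Model c e Ω) (l : ℝ → ℝ → ℝ)

theorem measurable_X : Measurable S.X := S.measurable_XC.prodMk S.measurable_XD

theorem measurable_index (d : Fin 2) :
    Measurable fun z : (Fin c → ℝ) × (Fin e → ℝ) => S.index d z.1 z.2 := by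
  unfold index
  fun_prop

theorem measurable_XV : Measurable fun ω => (S.X ω, S.V ω) :=
  S.measurable_X.prodMk S.measurable_V

variable {l} in
theorem measurable_Ypot (hl : Measurable (Function.uncurry l)) (d : Fin 2) :
    Measurable (S.Ypot l d) :=
  hl.comp (((S.measurable_index d).comp S.measurable_X).prodMk (S.measurable_err d))

/-- The pairs of covariates and treatment errors at which the treatment state is `d`. -/
def treatmentSet : Fin 2 → Set (((Fin c → ℝ) × (Fin e → ℝ)) × ℝ) :=
  ![{z | z.2 ≤ S.pscore z.1.1 z.1.2}ᶜ, {z | z.2 ≤ S.pscore z.1.1 z.1.2}]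

theorem measurableSet_treatmentSet (d : Fin 2) : MeasurableSet (S.treatmentSet d) := by
  have h : MeasurableSet {z : ((Fin c → ℝ) × (Fin e → ℝ)) × ℝ | z.2 ≤ S.pscore z.1.1 z.1.2} :=
    measurableSet_le measurable_snd (S.measurable_pscore.comp measurable_fst)
  fin_cases d
  · exact h.compl
  · exact h

theorem D_eq_iff (d : Fin 2) (ω : Ω) : S.D ω = (d : ℕ) ↔ (S.X ω, S.V ω) ∈ S.treatmentSet d := by
  by_cases h : S.V ω ≤ S.pscore (S.XC ω) (S.XD ω) <;> fin_cases d <;>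
    simp [D, treatmentSet, X, h]

theorem measurable_D : Measurable S.D :=
  measurable_one.indicator (S.measurable_XV (S.measurableSet_treatmentSet 1))

variable {l} in
theorem measurable_Y (hl : Measurable (Function.uncurry l)) : Measurable (S.Y l) :=
  (S.measurable_D.mul (S.measurable_Ypot hl 1)).add
    ((measurable_const.sub S.measurable_D).mul (S.measurable_Ypot hl 0))

variable {l} in
theorem measurable_obs (hl : Measurable (Function.uncurry l)) :
    Measurable fun ω => (S.Y l ω, S.D ω, S.X ω) :=
  (S.measurable_Y hl).prodMk (S.measurable_D.prodMk S.measurable_X)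

theorem Y_eq_Ypot {d : Fin 2} {ω : Ω} (h : S.D ω = (d : ℕ)) : S.Y l ω = S.Ypot l d ω := by
  fin_cases d <;> simp_all [Y]

variable {l} in
theorem map_X_eq_map_obsLaw (hl : Measurable (Function.uncurry l)) :
    S.μ.map S.X = (S.obsLaw l).map fun q => q.2.2 := by
  rw [obsLaw, Measure.map_map (by fun_prop) (S.measurable_obs hl)]
  rfl

variable {l} in
theorem measurable_condMean (hl : Measurable (Function.uncurry l)) (d : Fin 2) :
    Measurable fun z : ℝ × ℝ => S.condMean l d z.1 z.2 := by
  have h : StronglyMeasurable fun q : (ℝ × ℝ) × ℝ => l q.1.1 q.2 :=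
    (hl.comp ((measurable_fst.comp measurable_fst).prodMk measurable_snd)).stronglyMeasurable
  exact (h.integral_kernel_prod_right'
    (κ := (condDistrib (S.err d) S.V S.μ).comap Prod.snd measurable_snd)).measurable

/-! ### Conditional means of the observables as integrals over the treatment error. -/

variable {S l}

theorem Standing.map_XV (h : S.Standing l) :
    S.μ.map (fun ω => (S.X ω, S.V ω)) = (S.μ.map S.X).prod (volume.restrict (Icc 0 1)) := by
  rw [← h.uniform_V]
  exact (indepFun_iff_map_prod_eq_prod_map_map S.measurable_X.aemeasurable
    S.measurable_V.aemeasurable).1 h.indep_V.symm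

theorem Standing.integrable_condMean (h : S.Standing l) (hl : Measurable (Function.uncurry l))
    (d : Fin 2) (t : ℝ) : IntegrableOn (S.condMean l d t) (Icc 0 1) := by
  rw [IntegrableOn, ← h.uniform_V]
  have hm : Measurable fun q : ℝ × ℝ => l t q.2 :=
    hl.comp (measurable_const.prodMk measurable_snd)
  refine Integrable.integral_condDistrib_map (f := fun q : ℝ × ℝ => l t q.2)
    (S.measurable_err d).aemeasurable ?_
  rw [integrable_map_measure hm.aestronglyMeasurable
    (S.measurable_V.prodMk (S.measurable_err d)).aemeasurable]
  exact h.integrable_l d t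

/-- The integral of a function of `(X, V)` over an event on which `X ∈ B`, as an iterated
integral. -/
theorem Standing.setIntegral_XV (h : S.Standing l)
    {g : ((Fin c → ℝ) × (Fin e → ℝ)) × ℝ → ℝ} (hg : Measurable g)
    (hint : Integrable (fun ω => g (S.X ω, S.V ω)) S.μ)
    {A : Set (((Fin c → ℝ) × (Fin e → ℝ)) × ℝ)} (hA : MeasurableSet A) :
    Integrable (fun z => ∫ v in Icc 0 1, A.indicator g (z, v)) (S.μ.map S.X) ∧
    ∀ B, MeasurableSet B →
      ∫ ω in (fun ω => (S.X ω, S.V ω)) ⁻¹' (Prod.fst ⁻¹' B ∩ A), g (S.X ω, S.V ω) ∂S.μ =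
        ∫ z in B, (∫ v in Icc 0 1, A.indicator g (z, v)) ∂(S.μ.map S.X) := by
  have hint' : Integrable g ((S.μ.map S.X).prod (volume.restrict (Icc 0 1))) := by
    rw [← h.map_XV]
    exact (integrable_map_measure hg.aestronglyMeasurable S.measurable_XV.aemeasurable).2 hint
  refine ⟨(hint'.indicator hA).integral_prod_left, fun B hB => ?_⟩
  have hB' : MeasurableSet (Prod.fst ⁻¹' B : Set (((Fin c → ℝ) × (Fin e → ℝ)) × ℝ)) :=
    measurable_fst hB
  rw [← setIntegral_map (hB'.inter hA) hg.aestronglyMeasurable S.measurable_XV.aemeasurable,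
    h.map_XV, ← setIntegral_indicator hA]
  have : (Prod.fst ⁻¹' B : Set (((Fin c → ℝ) × (Fin e → ℝ)) × ℝ)) = B ×ˢ univ := by
    ext; simp
  rw [this, setIntegral_prod, Measure.restrict_univ]
  exact (hint'.indicator hA).integrableOn

/-- `E[Y_d | X, V]` is `E[l(t, V_d) | V]` at `t = X'γ_d`. -/
theorem CondIndep.condExp_Ypot [StandardBorelSpace Ω] {d : Fin 2} (hci : S.CondIndep d)
    (hl : Measurable (Function.uncurry l)) (hint : Integrable (S.Ypot l d) S.μ) :
    S.μ[S.Ypot l d | MeasurableSpace.comap (fun ω => (S.X ω, S.V ω)) inferInstance] =ᵐ[S.μ]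
      fun ω => S.condMean l d (S.index d (S.XC ω) (S.XD ω)) (S.V ω) := by
  have hVX : Measurable fun ω => (S.V ω, S.X ω) := S.measurable_V.prodMk S.measurable_X
  have hσ : MeasurableSpace.comap (fun ω => (S.X ω, S.V ω)) inferInstance =
      MeasurableSpace.comap (fun ω => (S.V ω, S.X ω)) inferInstance := by
    apply le_antisymm
    · exact (measurable_swap.comp (comap_measurable fun ω => (S.V ω, S.X ω))).comap_le
    · exact (measurable_swap.comp (comap_measurable fun ω => (S.X ω, S.V ω))).comap_le
  rw [hσ]
  -- The conditional law of `V_d` given `(V, X)` does not depend on `X`, so only the index is left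
  -- to carry `X`.
  have hdist := (condIndepFun_iff_condDistrib_prod_ae_eq_prodMkRight (μ := S.μ)
    (S.measurable_err d) S.measurable_X S.measurable_V).1 hci.symm
  have hcond := condExp_prod_ae_eq_integral_condDistrib (μ := S.μ) hVX
    (S.measurable_err d).aemeasurable
    (f := fun q : (ℝ × (Fin c → ℝ) × (Fin e → ℝ)) × ℝ => l (S.index d q.1.2.1 q.1.2.2) q.2)
    (Measurable.stronglyMeasurable (hl.comp (((S.measurable_index d).comp
      (measurable_snd.comp measurable_fst)).prodMk measurable_snd))) hint
  refine hcond.trans ?_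
  filter_upwards [ae_of_ae_map hVX.aemeasurable hdist] with ω hω
  rw [hω]
  rfl

/-- Integrating `E[l(t, V_d) | V = v]` over the treatment errors that lead to state `d`. -/
theorem integral_indicator_treatmentSet {d : Fin 2} {z : (Fin c → ℝ) × (Fin e → ℝ)}
    (hz : S.pscore z.1 z.2 ∈ Icc (0 : ℝ) 1) (t : ℝ) :
    ∫ v in Icc 0 1, (S.treatmentSet d).indicator (fun q => S.condMean l d t q.2) (z, v) =
      S.r l d t (S.pscore z.1 z.2) := by
  have key : ∀ (g : ℝ → ℝ) (s : Set ℝ), MeasurableSet s → ∀ J : Set ℝ, Icc 0 1 ∩ s = J →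
      ∫ v in Icc (0 : ℝ) 1, s.indicator g v = ∫ v in J, g v := by
    intro g s hs J hJ
    rw [setIntegral_indicator hs, hJ]
  fin_cases d
  · simp only [Fin.zero_eta, Fin.isValue, r, Matrix.cons_val_zero]
    rw [intervalIntegral.integral_of_le hz.2]
    refine Eq.trans ?_ (key (S.condMean l 0 t) (Ioi (S.pscore z.1 z.2)) measurableSet_Ioi _ ?_)
    · congr 1; ext v; simp [indicator, treatmentSet]
    · ext v; simp only [mem_inter_iff, mem_Icc, mem_Ioi, mem_Ioc]
      exact ⟨fun h => ⟨h.2, h.1.2⟩, fun h => ⟨⟨hz.1.trans h.1.le, h.2⟩, h.1⟩⟩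
  · simp only [Fin.mk_one, Fin.isValue, r, Matrix.cons_val_one, Matrix.cons_val_fin_one]
    -- The treated errors form the closed interval `[0, p]`, whereas interval integrals run over
    -- `(0, p]`; the endpoint is null. The untreated ones form `(p, 1]` exactly.
    rw [intervalIntegral.integral_of_le hz.1, ← integral_Icc_eq_integral_Ioc]
    refine Eq.trans ?_ (key (S.condMean l 1 t) (Iic (S.pscore z.1 z.2)) measurableSet_Iic _ ?_)
    · congr 1
    · ext v; simp only [mem_inter_iff, mem_Icc, mem_Iic]
      exact ⟨fun h => ⟨h.1.1, h.2⟩, fun h => ⟨⟨h.1, h.2.trans hz.2⟩, h.2⟩⟩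

/-- The observations with treatment state `d` and covariates in `B`. -/
def obsSet (d : Fin 2) (B : Set ((Fin c → ℝ) × (Fin e → ℝ))) :
    Set (ℝ × ℝ × (Fin c → ℝ) × (Fin e → ℝ)) :=
  {q | q.2.1 = (d : ℕ) ∧ q.2.2 ∈ B}

theorem measurableSet_obsSet (d : Fin 2) {B : Set ((Fin c → ℝ) × (Fin e → ℝ))}
    (hB : MeasurableSet B) : MeasurableSet (obsSet d B) :=
  (measurableSet_eq_fun (measurable_fst.comp measurable_snd) measurable_const).inter
    ((measurable_snd.comp measurable_snd) hB)

variable (S l) in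
theorem preimage_obsSet (d : Fin 2) (B : Set ((Fin c → ℝ) × (Fin e → ℝ))) :
    (fun ω => (S.Y l ω, S.D ω, S.X ω)) ⁻¹' obsSet d B =
      (fun ω => (S.X ω, S.V ω)) ⁻¹' (Prod.fst ⁻¹' B ∩ S.treatmentSet d) := by
  ext ω
  simp only [obsSet, mem_preimage, mem_ofPred_eq, mem_inter_iff, S.D_eq_iff d ω]
  exact and_comm

/-- The conditional mean of the outcome in treatment state `d`, expressed in the observables. -/
theorem Standing.setIntegral_r [StandardBorelSpace Ω] (h : S.Standing l) {d : Fin 2}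
    (hci : S.CondIndep d) (hl : Measurable (Function.uncurry l)) :
    Integrable (fun z => S.r l d (S.index d z.1 z.2) (S.pscore z.1 z.2)) (S.μ.map S.X) ∧
    ∀ B, MeasurableSet B →
      ∫ z in B, S.r l d (S.index d z.1 z.2) (S.pscore z.1 z.2) ∂(S.μ.map S.X) =
        ∫ q in obsSet d B, q.1 ∂(S.obsLaw l) := by
  have hce := hci.condExp_Ypot hl (h.integrable_Y d)
  have hgm : Measurable fun q : ((Fin c → ℝ) × (Fin e → ℝ)) × ℝ =>
      S.condMean l d (S.index d q.1.1 q.1.2) q.2 :=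
    (S.measurable_condMean hl d).comp
      (((S.measurable_index d).comp measurable_fst).prodMk measurable_snd)
  have hgi : Integrable (fun ω => S.condMean l d (S.index d (S.X ω).1 (S.X ω).2) (S.V ω)) S.μ :=
    integrable_condExp.congr hce
  obtain ⟨hi, hB⟩ := h.setIntegral_XV hgm hgi (S.measurableSet_treatmentSet d)
  have hr : ∀ z : (Fin c → ℝ) × (Fin e → ℝ),
      ∫ v in Icc 0 1, (S.treatmentSet d).indicator
        (fun q => S.condMean l d (S.index d q.1.1 q.1.2) q.2) (z, v) =
      S.r l d (S.index d z.1 z.2) (S.pscore z.1 z.2) := fun z => by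
    rw [← integral_indicator_treatmentSet (h.pscore_mem z.1 z.2)]
    rfl
  simp only [hr] at hi hB
  refine ⟨hi, fun B hBm => ?_⟩
  have hs : MeasurableSet (Prod.fst ⁻¹' B ∩ S.treatmentSet d) :=
    (measurable_fst hBm).inter (S.measurableSet_treatmentSet d)
  rw [← hB B hBm, obsLaw, setIntegral_map (measurableSet_obsSet d hBm)
    measurable_fst.aestronglyMeasurable (S.measurable_obs hl).aemeasurable, preimage_obsSet]
  -- The event is measurable with respect to `(X, V)`, so `Y_d` may be exchanged for its conditional
  -- expectation; on this event `Y = Y_d`.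
  have h1 : ∫ ω in (fun ω => (S.X ω, S.V ω)) ⁻¹' (Prod.fst ⁻¹' B ∩ S.treatmentSet d),
      S.Ypot l d ω ∂S.μ = _ :=
    (setIntegral_condExp S.measurable_XV.comap_le (h.integrable_Y d) ⟨_, hs, rfl⟩).symm.trans
      (setIntegral_congr_ae (S.measurable_XV hs) (hce.mono fun ω hω _ => hω))
  refine h1.symm.trans (setIntegral_congr_fun (S.measurable_XV hs) fun ω hω => ?_)
  exact (S.Y_eq_Ypot l ((S.D_eq_iff d ω).2 hω.2)).symm

/-- The propensity score is the conditional probability of treatment. -/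
theorem Standing.setIntegral_pscore (h : S.Standing l) (hl : Measurable (Function.uncurry l)) :
    Integrable (fun z => S.pscore z.1 z.2) (S.μ.map S.X) ∧
    ∀ B, MeasurableSet B → ∫ z in B, S.pscore z.1 z.2 ∂(S.μ.map S.X) =
        (S.obsLaw l).real (obsSet 1 B) := by
  obtain ⟨hi, hB⟩ := h.setIntegral_XV (g := fun _ => 1) measurable_const (integrable_const _)
    (S.measurableSet_treatmentSet 1)
  have hr : ∀ z : (Fin c → ℝ) × (Fin e → ℝ),
      ∫ v in Icc 0 1, (S.treatmentSet 1).indicator (fun _ => (1 : ℝ)) (z, v) =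
        S.pscore z.1 z.2 := fun z => by
    have hz := h.pscore_mem z.1 z.2
    have h1 : ∫ v in Icc 0 1, (Iic (S.pscore z.1 z.2)).indicator (fun _ => (1 : ℝ)) v =
        S.pscore z.1 z.2 := by
      rw [setIntegral_indicator measurableSet_Iic]
      have : Icc 0 1 ∩ Iic (S.pscore z.1 z.2) = Icc 0 (S.pscore z.1 z.2) := by
        ext v; simp only [mem_inter_iff, mem_Icc, mem_Iic]
        exact ⟨fun h => ⟨h.1.1, h.2⟩, fun h => ⟨⟨h.1, h.2.trans hz.2⟩, h.2⟩⟩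
      rw [this]
      simp [hz.1]
    exact h1
  simp only [hr] at hi hB
  refine ⟨hi, fun B hBm => ?_⟩
  rw [← hB B hBm, obsLaw, map_measureReal_apply (S.measurable_obs hl) (measurableSet_obsSet 1 hBm),
    preimage_obsSet]
  simp

/-! ### Almost sure agreement of two observationally equivalent structures. -/

section TwoModels

variable {Ω' : Type*} [MeasurableSpace Ω'] {S' : Model c e Ω'}

theorem map_X_eq (hl : Measurable (Function.uncurry l)) (hobs : S.obsLaw l = S'.obsLaw l) :
    S.μ.map S.X = S'.μ.map S'.X := by
  rw [map_X_eq_map_obsLaw S hl, map_X_eq_map_obsLaw S' hl, hobs]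

theorem Standing.pscore_ae_eq (h : S.Standing l) (h' : S'.Standing l)
    (hl : Measurable (Function.uncurry l)) (hobs : S.obsLaw l = S'.obsLaw l) :
    ∀ᵐ z ∂(S.μ.map S.X), S.pscore z.1 z.2 = S'.pscore z.1 z.2 := by
  obtain ⟨hi, hB⟩ := h.setIntegral_pscore hl
  obtain ⟨hi', hB'⟩ := h'.setIntegral_pscore hl
  rw [← map_X_eq hl hobs] at hi' hB'
  exact hi.ae_eq_of_forall_setIntegral_eq _ _ hi' fun B hBm _ => by
    rw [hB B hBm, hB' B hBm, hobs]

theorem Standing.r_ae_eq [StandardBorelSpace Ω] [StandardBorelSpace Ω'] (h : S.Standing l)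
    (h' : S'.Standing l) {d : Fin 2} (hci : S.CondIndep d) (hci' : S'.CondIndep d)
    (hl : Measurable (Function.uncurry l)) (hobs : S.obsLaw l = S'.obsLaw l) :
    ∀ᵐ z ∂(S.μ.map S.X), S.r l d (S.index d z.1 z.2) (S.pscore z.1 z.2) =
      S'.r l d (S'.index d z.1 z.2) (S'.pscore z.1 z.2) := by
  obtain ⟨hi, hB⟩ := h.setIntegral_r hci hl
  obtain ⟨hi', hB'⟩ := h'.setIntegral_r hci' hl
  rw [← map_X_eq hl hobs] at hi' hB'
  exact hi.ae_eq_of_forall_setIntegral_eq _ _ hi' fun B hBm _ => by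
    rw [hB B hBm, hB' B hBm, hobs]

end TwoModels
-- From almost sure equality to equality on the support.
variable (S) in
theorem suppAt_eq_support_map (xd : Fin e → ℝ) :
    S.suppAt xd = (((S.μ.map S.X).restrict (Prod.snd ⁻¹' {xd})).map Prod.fst).support := by
  have hs : MeasurableSet (Prod.snd ⁻¹' {xd} : Set ((Fin c → ℝ) × (Fin e → ℝ))) :=
    measurable_snd (measurableSet_singleton xd)
  rw [suppAt, Measure.restrict_map S.measurable_X hs, Measure.map_map measurable_fst
    S.measurable_X]
  rfl

theorem index_zero_right (d : Fin 2) (xc : Fin c → ℝ) :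
    S.index d xc 0 = ∑ i, xc i * S.γC d i := by
  simp [index]

theorem index_single (d : Fin 2) (xc : Fin c → ℝ) (k : Fin e) (a : ℝ) :
    S.index d xc (Pi.single k a) = (∑ i, xc i * S.γC d i) + a * S.γD d k := by
  simp [index, Pi.single_apply]

/-- Functions of the covariates that agree almost surely and are continuous in `x^C` agree on the
support. -/
theorem eqOn_suppAt {f g : (Fin c → ℝ) × (Fin e → ℝ) → ℝ}
    (hae : ∀ᵐ z ∂(S.μ.map S.X), f z = g z) {xd : Fin e → ℝ}
    (hf : ContinuousOn (fun xc => f (xc, xd)) (S.suppAt xd))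
    (hg : ContinuousOn (fun xc => g (xc, xd)) (S.suppAt xd)) {xc : Fin c → ℝ}
    (hx : xc ∈ S.suppAt xd) : f (xc, xd) = g (xc, xd) := by
  refine eq_of_mem_support_map (f := fun xc => f (xc, xd)) (g := fun xc => g (xc, xd))
    (μ := S.μ.restrict (S.XD ⁻¹' {xd})) (h := S.XC) S.measurable_XC.aemeasurable
    Measure.isClosed_support hf hg ?_ hx
  have h1 := ae_restrict_of_ae (s := S.XD ⁻¹' {xd}) (ae_of_ae_map S.measurable_X.aemeasurable hae)
  have h2 := ae_restrict_mem (μ := S.μ) (S.measurable_XD (measurableSet_singleton xd))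
  have h3 : ∀ᵐ ω ∂(S.μ.restrict (S.XD ⁻¹' {xd})), S.XC ω ∈ S.suppAt xd :=
    ae_of_ae_map S.measurable_XC.aemeasurable Measure.support_mem_ae
  filter_upwards [h1, h2, h3] with ω h1 h2 h3
  refine ⟨h3, ?_⟩
  have : S.X ω = (S.XC ω, xd) := Prod.ext rfl h2
  rwa [this] at h1

theorem Standing.continuousOn_r (h : S.Standing l) {d : Fin 2} (hs : S.Smooth l d)
    (xd : Fin e → ℝ) :
    ContinuousOn (fun xc => S.r l d (S.index d xc xd) (S.pscore xc xd)) (S.suppAt xd) := by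
  refine hs.r_cont.comp (f := fun xc => (S.index d xc xd, S.pscore xc xd)) (.prodMk ?_
    (h.pscore_cont xd)) fun xc _ => ⟨mem_univ _, h.pscore_mem xc xd⟩
  unfold index
  fun_prop

/-- Invertibility rules out degenerate values of the propensity score. -/
theorem pscore_mem_Ioo (h : S.Standing l) (hinv : ∀ d, S.Invertible l d) {xd : Fin e → ℝ}
    {xc : Fin c → ℝ} (hx : xc ∈ S.suppAt xd) : S.pscore xc xd ∈ Ioo (0 : ℝ) 1 := by
  have hm := h.pscore_mem xc xd
  refine ⟨lt_of_le_of_ne hm.1 fun h0 => ?_, lt_of_le_of_ne hm.2 fun h1 => ?_⟩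
  -- At score `0` the integral defining `r₁` is over a degenerate interval, hence zero for every
  -- `t`; at score `1` the same happens to `r₀`.
  · exact zero_ne_one (hinv 1 xd xc hx (a₁ := 0) (a₂ := 1) (by simp [r, ← h0]))
  · exact zero_ne_one (hinv 0 xd xc hx (a₁ := 0) (a₂ := 1) (by simp [r, h1]))

/-! ### Gradients and the algebra that separates the coefficients. -/

section Deriv

variable {d : Fin 2} {t p : ℝ}

theorem Smooth.differentiableAt (hs : S.Smooth l d) (hp : p ∈ Ioo (0 : ℝ) 1) :
    DifferentiableAt ℝ (Function.uncurry (S.r l d)) (t, p) :=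
  (hs.r_diff (t, p) ⟨mem_univ _, hp⟩).differentiableAt
    ((isOpen_univ.prod isOpen_Ioo).mem_nhds ⟨mem_univ _, hp⟩)

theorem Smooth.hasDerivAt_fst (hs : S.Smooth l d) (hp : p ∈ Ioo (0 : ℝ) 1) :
    HasDerivAt (fun s => S.r l d s p) (fderiv ℝ (Function.uncurry (S.r l d)) (t, p) (1, 0)) t :=
  (hs.differentiableAt hp).hasFDerivAt.comp_hasDerivAt (f := fun s => (s, p)) t
    ((hasDerivAt_id t).prodMk (hasDerivAt_const t p))

theorem Smooth.hasDerivAt_snd (hs : S.Smooth l d) (hp : p ∈ Ioo (0 : ℝ) 1) :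
    HasDerivAt (fun q => S.r l d t q) (fderiv ℝ (Function.uncurry (S.r l d)) (t, p) (0, 1)) p :=
  (hs.differentiableAt hp).hasFDerivAt.comp_hasDerivAt (f := fun q => (t, q)) p
    ((hasDerivAt_const p t).prodMk (hasDerivAt_id p))

theorem Smooth.fderiv_apply (hs : S.Smooth l d) (hp : p ∈ Ioo (0 : ℝ) 1) (u v : ℝ) :
    fderiv ℝ (Function.uncurry (S.r l d)) (t, p) (u, v) =
      S.d1r l d t p * u + S.d2r l d t p * v := by
  rw [d1r, d2r, (hs.hasDerivAt_fst hp).deriv, (hs.hasDerivAt_snd hp).deriv]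
  have : ((u, v) : ℝ × ℝ) = u • ((1, 0) : ℝ × ℝ) + v • ((0, 1) : ℝ × ℝ) := by simp
  rw [this, map_add, map_smul, map_smul, smul_eq_mul, smul_eq_mul]
  ring

/-- Chain rule for the conditional mean outcome as a function of `x^C` given `X^D = 0`. -/
theorem Smooth.fderivWithin_r_apply (hs : S.Smooth l d) {x : Fin c → ℝ} (hx : x ∈ S.suppAt 0)
    (hu : UniqueDiffWithinAt ℝ (S.suppAt 0) x) (hp : S.pscore₀ x ∈ Ioo (0 : ℝ) 1) (k : Fin c) :
    fderivWithin ℝ (fun y => S.r l d (∑ i, y i * S.γC d i) (S.pscore₀ y)) (S.suppAt 0) x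
        (Pi.single k 1) =
      S.d1r l d (∑ i, x i * S.γC d i) (S.pscore₀ x) * S.γC d k +
        S.d2r l d (∑ i, x i * S.γC d i) (S.pscore₀ x) * S.dpscore₀ k x := by
  let L : (Fin c → ℝ) →L[ℝ] ℝ := ∑ i, S.γC d i • ContinuousLinearMap.proj i
  have hL : ∀ y, L y = ∑ i, y i * S.γC d i := fun y => by
    simp [L, mul_comm]
  have h1 : HasFDerivWithinAt (fun y : Fin c → ℝ => ∑ i, y i * S.γC d i) L (S.suppAt 0) x := by
    simp only [← hL]
    exact L.hasFDerivWithinAt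
  have h2 := (hs.pscore₀_diff x hx).hasFDerivWithinAt
  have h3 := (hs.differentiableAt (t := ∑ i, x i * S.γC d i) hp).hasFDerivAt.comp_hasFDerivWithinAt
    (f := fun y => (∑ i, y i * S.γC d i, S.pscore₀ y)) x (h1.prodMk h2)
  have h4 : fderivWithin ℝ (fun y => S.r l d (∑ i, y i * S.γC d i) (S.pscore₀ y)) (S.suppAt 0) x =
    _ := h3.fderivWithin hu
  rw [h4, ContinuousLinearMap.comp_apply, ContinuousLinearMap.prod_apply, hs.fderiv_apply hp, hL]
  simp [Pi.single_apply, dpscore₀]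

end Deriv

/-- The algebraic core of the identification of the coefficients: two index structures that produce
the same gradient at two points coincide if the gradients `q`, `q'` of the propensity score at these
points are in general position with respect to the coefficients. -/
theorem coef_eq_of_gradient_eq [NeZero c] {γ γ₁ q q' : Fin c → ℝ} {A B A₁ B₁ A' B' A₁' B₁' : ℝ}
    (hγ : γ 0 = 1) (hγ₁ : γ₁ 0 = 1)
    (h : ∀ i, A * γ i + B * q i = A₁ * γ₁ i + B₁ * q i)
    (h' : ∀ i, A' * γ i + B' * q' i = A₁' * γ₁ i + B₁' * q' i)
    (hA : A ≠ 0) (hA' : A' ≠ 0) {k j : Fin c} (hk : q k ≠ q 0 * γ k)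
    (hdet : q k * q' j - q' k * q j ≠
      (q 0 * q' j - q' 0 * q j) * γ k - (q 0 * q' k - q' 0 * q k) * γ j) :
    γ = γ₁ := by
  have e0 := h 0
  have e0' := h' 0
  rw [hγ, hγ₁] at e0 e0'
  -- Coordinate `0` reads `A = A₁ + (B₁ - B) q 0`; substituting this for `A` in coordinate `i` gives
  -- the relation.
  have d : ∀ i, A₁ * (γ i - γ₁ i) = (B₁ - B) * (q i - q 0 * γ i) := fun i => by
    linear_combination h i - γ i * e0
  have d' : ∀ i, A₁' * (γ i - γ₁ i) = (B₁' - B') * (q' i - q' 0 * γ i) := fun i => by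
    linear_combination h' i - γ i * e0'
  by_cases hB : B₁ - B = 0
  · ext i
    have : A * (γ i - γ₁ i) = 0 := by linear_combination d i + (γ i - γ₁ i) * (e0 + q 0 * hB) +
      (q i - q 0 * γ i) * hB
    exact sub_eq_zero.1 ((mul_eq_zero.1 this).resolve_left hA)
  by_cases hB' : B₁' - B' = 0
  · ext i
    have : A' * (γ i - γ₁ i) = 0 := by linear_combination d' i + (γ i - γ₁ i) * (e0' + q' 0 * hB') +
      (q' i - q' 0 * γ i) * hB'
    exact sub_eq_zero.1 ((mul_eq_zero.1 this).resolve_left hA')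
  exfalso
  have hk0 : A₁ * (γ k - γ₁ k) ≠ 0 := by rw [d k]; exact mul_ne_zero hB (sub_ne_zero.2 hk)
  have hA₁ : A₁ ≠ 0 := left_ne_zero_of_mul hk0
  -- By `d` and `d'` both products equal `A₁ A₁' (γ k - γ₁ k) (γ j - γ₁ j)`. The minor in the last
  -- factor expands to the difference of the two sides of `hdet`.
  have hcross : (B₁ - B) * (B₁' - B') * ((q k - q 0 * γ k) * (q' j - q' 0 * γ j) -
      (q' k - q' 0 * γ k) * (q j - q 0 * γ j)) = 0 := by
    linear_combination (-(B₁' - B') * (q' j - q' 0 * γ j)) * d k - A₁ * (γ k - γ₁ k) * d' j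
      + A₁' * (γ k - γ₁ k) * d j + (B₁ - B) * (q j - q 0 * γ j) * d' k
  have := (mul_eq_zero.1 hcross).resolve_left (mul_ne_zero hB hB')
  exact hdet (by linear_combination this)

/-! ### Identification of the coefficients, of `r_d` and of its derivative in `p`. -/

variable (S) in
theorem measurable_index_pscore (d : Fin 2) :
    Measurable fun z : (Fin c → ℝ) × (Fin e → ℝ) => (S.index d z.1 z.2, S.pscore z.1 z.2) :=
  (S.measurable_index d).prodMk S.measurable_pscore

variable (S) in
theorem indexSupp_eq_support_map (d : Fin 2) :
    S.indexSupp d =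
      ((S.μ.map S.X).map fun z => (S.index d z.1 z.2, S.pscore z.1 z.2)).support := by
  rw [Measure.map_map (S.measurable_index_pscore d) S.measurable_X]
  rfl

section TwoModels

variable {Ω' : Type*} [MeasurableSpace Ω'] {S' : Model c e Ω'}

theorem suppAt_eq (hl : Measurable (Function.uncurry l)) (hobs : S.obsLaw l = S'.obsLaw l)
    (xd : Fin e → ℝ) : S.suppAt xd = S'.suppAt xd := by
  rw [suppAt_eq_support_map, suppAt_eq_support_map, map_X_eq hl hobs]

theorem Standing.pscore_eq (h : S.Standing l) (h' : S'.Standing l)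
    (hl : Measurable (Function.uncurry l)) (hobs : S.obsLaw l = S'.obsLaw l)
    {xd : Fin e → ℝ} {xc : Fin c → ℝ} (hx : xc ∈ S.suppAt xd) :
    S.pscore xc xd = S'.pscore xc xd :=
  eqOn_suppAt (f := fun z => S.pscore z.1 z.2) (g := fun z => S'.pscore z.1 z.2)
    (h.pscore_ae_eq h' hl hobs) (h.pscore_cont xd)
    (by rw [suppAt_eq hl hobs]; exact h'.pscore_cont xd) hx

variable [StandardBorelSpace Ω] [StandardBorelSpace Ω']

theorem Standing.r_eq (h : S.Standing l) (h' : S'.Standing l) {d : Fin 2}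
    (hci : S.CondIndep d) (hci' : S'.CondIndep d) (hs : S.Smooth l d) (hs' : S'.Smooth l d)
    (hl : Measurable (Function.uncurry l)) (hobs : S.obsLaw l = S'.obsLaw l)
    {xd : Fin e → ℝ} {xc : Fin c → ℝ} (hx : xc ∈ S.suppAt xd) :
    S.r l d (S.index d xc xd) (S.pscore xc xd) =
      S'.r l d (S'.index d xc xd) (S'.pscore xc xd) :=
  eqOn_suppAt (f := fun z => S.r l d (S.index d z.1 z.2) (S.pscore z.1 z.2))
    (g := fun z => S'.r l d (S'.index d z.1 z.2) (S'.pscore z.1 z.2))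
    (h.r_ae_eq h' hci hci' hl hobs) (h.continuousOn_r hs xd)
    (by rw [suppAt_eq hl hobs]; exact h'.continuousOn_r hs' xd) hx

variable [NeZero c]

/-- The two regression functions and the two scores agree only on the support, so gradients are
taken within it. They are unique at the two points of the non-linearity condition for `S`, where the
chain rule yields two expressions for one gradient. -/
theorem Admissible.γC_eq (h : S.Admissible l) (h' : S'.Admissible l)
    (hl : Measurable (Function.uncurry l)) (hobs : S.obsLaw l = S'.obsLaw l) (d : Fin 2) :
    S.γC d = S'.γC d := by
  obtain ⟨hs, x, hx, x', hx', hu, hu', k, j, hA, hA', hk, -, -, hdet⟩ := h.nonLinear d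
  have hs' := (h'.nonLinear d).1
  have hsupp := suppAt_eq hl hobs (0 : Fin e → ℝ)
  have hπ : EqOn S'.pscore₀ S.pscore₀ (S.suppAt 0) := fun y hy =>
    (h.standing.pscore_eq h'.standing hl hobs hy).symm
  have hr : EqOn (fun y => S'.r l d (∑ i, y i * S'.γC d i) (S'.pscore₀ y))
      (fun y => S.r l d (∑ i, y i * S.γC d i) (S.pscore₀ y)) (S.suppAt 0) := fun y hy => by
    have := h.standing.r_eq h'.standing (h.condIndep d) (h'.condIndep d) hs hs' hl hobs hy
    rw [index_zero_right, index_zero_right] at this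
    exact this.symm
  have key : ∀ y ∈ S.suppAt 0, UniqueDiffWithinAt ℝ (S.suppAt 0) y → ∀ i,
      S.d1r l d (∑ i, y i * S.γC d i) (S.pscore₀ y) * S.γC d i +
        S.d2r l d (∑ i, y i * S.γC d i) (S.pscore₀ y) * S.dpscore₀ i y =
      S'.d1r l d (∑ i, y i * S'.γC d i) (S'.pscore₀ y) * S'.γC d i +
        S'.d2r l d (∑ i, y i * S'.γC d i) (S'.pscore₀ y) * S.dpscore₀ i y := by
    intro y hy huy i
    have hy' := hsupp ▸ hy
    have hd : S'.dpscore₀ i y = S.dpscore₀ i y := by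
      rw [dpscore₀, dpscore₀, ← hsupp, fderivWithin_congr hπ (hπ hy)]
    have e1 := hs.fderivWithin_r_apply hy huy (pscore_mem_Ioo h.standing h.invertible hy) i
    have e2 := hs'.fderivWithin_r_apply hy' (hsupp ▸ huy)
      (pscore_mem_Ioo h'.standing h'.invertible hy') i
    rw [← hsupp, fderivWithin_congr hr (hr hy), hd] at e2
    exact e1.symm.trans e2
  exact coef_eq_of_gradient_eq (h.normalized d) (h'.normalized d) (key x hx hu) (key x' hx' hu')
    hA hA' hk hdet

/-- At `X^D = 0` the index involves only `γ^C`, which is already common, so both functions are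
evaluated at the same point. -/
theorem Admissible.r_eqOn_indexSupp₀ (h : S.Admissible l) (h' : S'.Admissible l)
    (hl : Measurable (Function.uncurry l)) (hobs : S.obsLaw l = S'.obsLaw l) {d : Fin 2}
    {z : ℝ × ℝ} (hz : z ∈ S.indexSupp₀ d) : S.r l d z.1 z.2 = S'.r l d z.1 z.2 := by
  have hπm : Measurable S.pscore₀ := S.measurable_pscore.comp (measurable_id.prodMk measurable_const)
  have hm : Measurable fun ω => (∑ i, S.XC ω i * S.γC d i, S.pscore₀ (S.XC ω)) := by
    refine Measurable.prodMk ?_ (hπm.comp S.measurable_XC)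
    have := S.measurable_XC
    fun_prop
  refine eq_of_mem_support_map (f := Function.uncurry (S.r l d))
    (g := Function.uncurry (S'.r l d)) hm.aemeasurable (isClosed_univ.prod isClosed_Icc)
    (h.nonLinear d).1.r_cont (h'.nonLinear d).1.r_cont ?_ hz
  have h3 : ∀ᵐ ω ∂(S.μ.restrict (S.XD ⁻¹' {0})), S.XC ω ∈ S.suppAt 0 :=
    ae_of_ae_map S.measurable_XC.aemeasurable Measure.support_mem_ae
  filter_upwards [h3] with ω hω
  refine ⟨⟨mem_univ _, h.standing.pscore_mem _ _⟩, ?_⟩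
  have := h.standing.r_eq h'.standing (h.condIndep d) (h'.condIndep d) (h.nonLinear d).1
    (h'.nonLinear d).1 hl hobs hω
  rwa [index_zero_right, index_zero_right, ← h.γC_eq h' hl hobs d,
    ← h.standing.pscore_eq h'.standing hl hobs hω] at this

theorem Admissible.γD_eq (h : S.Admissible l) (h' : S'.Admissible l)
    (hl : Measurable (Function.uncurry l)) (hobs : S.obsLaw l = S'.obsLaw l) (d : Fin 2) :
    S.γD d = S'.γD d := by
  ext k
  obtain ⟨a, ha, xc, hx, hmem⟩ := h.supportCond d k
  have e1 := h.r_eqOn_indexSupp₀ h' hl hobs hmem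
  have e2 := h.standing.r_eq h'.standing (h.condIndep d) (h'.condIndep d) (h.nonLinear d).1
    (h'.nonLinear d).1 hl hobs hx
  rw [index_single, index_single, ← h.γC_eq h' hl hobs d] at e2
  -- Both sides are values of the second structure's `r_d`, at the indices formed with the two
  -- candidate coefficients. Once the scores are identified, injectivity equates the indices, and `a
  -- ≠ 0` is cancelled.
  have e3 := e1.symm.trans e2
  dsimp only at e3
  rw [h.standing.pscore_eq h'.standing hl hobs hx] at e3
  have e4 := h'.invertible d _ xc (suppAt_eq hl hobs _ ▸ hx) e3
  exact mul_left_cancel₀ ha (add_left_cancel e4)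

theorem Admissible.index_eq (h : S.Admissible l) (h' : S'.Admissible l)
    (hl : Measurable (Function.uncurry l)) (hobs : S.obsLaw l = S'.obsLaw l) (d : Fin 2) :
    S.index d = S'.index d := by
  unfold index
  rw [h.γC_eq h' hl hobs d, h.γD_eq h' hl hobs d]

theorem Admissible.indexSupp_eq (h : S.Admissible l) (h' : S'.Admissible l)
    (hl : Measurable (Function.uncurry l)) (hobs : S.obsLaw l = S'.obsLaw l) (d : Fin 2) :
    S.indexSupp d = S'.indexSupp d := by
  rw [indexSupp_eq_support_map, indexSupp_eq_support_map, ← map_X_eq hl hobs,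
    h.index_eq h' hl hobs d]
  congr 1
  refine Measure.map_congr ?_
  filter_upwards [h.standing.pscore_ae_eq h'.standing hl hobs] with z hz
  rw [hz]

theorem Admissible.r_eqOn_indexSupp (h : S.Admissible l) (h' : S'.Admissible l)
    (hl : Measurable (Function.uncurry l)) (hobs : S.obsLaw l = S'.obsLaw l) {d : Fin 2}
    {t p : ℝ} (hz : (t, p) ∈ S.indexSupp d) : S.r l d t p = S'.r l d t p := by
  rw [indexSupp_eq_support_map] at hz
  refine eq_of_mem_support_map (f := Function.uncurry (S.r l d))
    (g := Function.uncurry (S'.r l d)) (S.measurable_index_pscore d).aemeasurable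
    (isClosed_univ.prod isClosed_Icc)
    (h.nonLinear d).1.r_cont (h'.nonLinear d).1.r_cont ?_ hz
  filter_upwards [h.standing.pscore_ae_eq h'.standing hl hobs,
    h.standing.r_ae_eq h'.standing (h.condIndep d) (h'.condIndep d) hl hobs] with z h1 h2
  refine ⟨⟨mem_univ _, h.standing.pscore_mem _ _⟩, ?_⟩
  rwa [← h.index_eq h' hl hobs d, ← h1] at h2

/-- On the line, a derivative within a set is unique exactly at accumulation points of the set.
Hence agreement of `r_d(t, ·)` on the section of the support determines `∂₂r_d` there. -/
theorem Admissible.d2r_eq (h : S.Admissible l) (h' : S'.Admissible l)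
    (hl : Measurable (Function.uncurry l)) (hobs : S.obsLaw l = S'.obsLaw l) {d : Fin 2}
    {t v : ℝ} (hv : v ∈ Ioo (0 : ℝ) 1)
    (hacc : AccPt v (Filter.principal {p | (t, p) ∈ S.indexSupp d})) :
    S.d2r l d t v = S'.d2r l d t v := by
  have hu := uniqueDiffWithinAt_iff_accPt.2 hacc
  have hcl : IsClosed {p | (t, p) ∈ S.indexSupp d} :=
    Measure.isClosed_support.preimage (Continuous.prodMk_right t)
  have hmem : v ∈ {p | (t, p) ∈ S.indexSupp d} := hcl.closure_subset hu.mem_closure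
  have h1 := ((h.nonLinear d).1.hasDerivAt_snd (t := t) hv)
  have h2 := ((h'.nonLinear d).1.hasDerivAt_snd (t := t) hv)
  rw [d2r, d2r, ← h1.differentiableAt.derivWithin hu, ← h2.differentiableAt.derivWithin hu]
  exact derivWithin_congr (fun p hp => h.r_eqOn_indexSupp h' hl hobs hp)
    (h.r_eqOn_indexSupp h' hl hobs hmem)

end TwoModels
-- The marginal treatment effect.
/-- By the Lebesgue differentiation theorem, `∂₂r_d(t, ·)` is `E[l(t, V_d) | V = ·]` up to the
sign `-1` for `d = 0`. -/
theorem Standing.d2r_ae_eq (h : S.Standing l) (hl : Measurable (Function.uncurry l)) (d : Fin 2)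
    (t : ℝ) : ∀ᵐ v ∂(volume.restrict (Icc (0 : ℝ) 1)),
      S.d2r l d t v = (![-1, 1] : Fin 2 → ℝ) d * S.condMean l d t v := by
  have hint : IntervalIntegrable (S.condMean l d t) volume 0 1 :=
    (intervalIntegrable_iff_integrableOn_Icc_of_le zero_le_one).2 (h.integrable_condMean hl d t)
  rw [ae_restrict_iff' measurableSet_Icc]
  filter_upwards [hint.ae_hasDerivAt_integral] with v hv hmem
  rw [uIcc_of_le zero_le_one] at hv
  fin_cases d
  -- For `d = 0` the variable is the lower limit: the integral is based at `1` and reversed, which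
  -- produces the sign.
  · have h1 := (hv hmem 1 (right_mem_Icc.2 zero_le_one)).neg
    have h2 : (fun q => S.r l 0 t q) = fun q => -∫ v in (1 : ℝ)..q, S.condMean l 0 t v := by
      ext q
      simp only [r, Matrix.cons_val_zero]
      exact intervalIntegral.integral_symm _ _
    simp only [d2r, Fin.zero_eta, Fin.isValue, h2, Matrix.cons_val_zero, neg_mul, one_mul]
    exact h1.deriv
  · have h1 := hv hmem 0 (left_mem_Icc.2 zero_le_one)
    simp only [d2r, Fin.mk_one, Fin.isValue, Matrix.cons_val_one, Matrix.cons_val_fin_one, one_mul]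
    exact h1.deriv

/-- Joint continuity of `r_d` is known only for `p` in `[0, 1]`. Extending it constantly in `p`
beyond the endpoints gives a continuous function, whose derivative in `p` is jointly measurable and
unchanged on `(0, 1)`. -/
theorem Smooth.exists_measurable_d2r {d : Fin 2} (hs : S.Smooth l d) :
    ∃ g : ℝ × ℝ → ℝ, Measurable g ∧ ∀ t, ∀ v ∈ Ioo (0 : ℝ) 1, g (t, v) = S.d2r l d t v := by
  let f : ℝ → ℝ → ℝ := fun t p => S.r l d t (projIcc 0 1 zero_le_one p)
  have hf : Continuous (Function.uncurry f) :=
    hs.r_cont.comp_continuous (f := fun q : ℝ × ℝ => (q.1, (projIcc 0 1 zero_le_one q.2 : ℝ)))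
      (continuous_fst.prodMk (continuous_subtype_val.comp
        ((continuous_projIcc (h := zero_le_one)).comp continuous_snd)))
      fun q => ⟨mem_univ _, (projIcc 0 1 zero_le_one q.2).2⟩
  refine ⟨_, measurable_deriv_with_param hf, fun t v hv => ?_⟩
  refine Filter.EventuallyEq.deriv_eq ?_
  filter_upwards [isOpen_Ioo.mem_nhds hv] with p hp
  simp only [f]
  rw [projIcc_of_mem zero_le_one (Ioo_subset_Icc_self hp)]

/-- The exceptional null set of `v` depends on `t`, so a random `t` cannot simply be substituted.
Independence of `X` and `V` allows Fubini, for which the exceptional set must be jointly measurable.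
-/
theorem Standing.d2r_index_ae_eq (h : S.Standing l) (hl : Measurable (Function.uncurry l))
    {d : Fin 2} (hs : S.Smooth l d) :
    ∀ᵐ ω ∂S.μ, S.d2r l d (S.index d (S.XC ω) (S.XD ω)) (S.V ω) =
      (![-1, 1] : Fin 2 → ℝ) d * S.condMean l d (S.index d (S.XC ω) (S.XD ω)) (S.V ω) := by
  obtain ⟨g, hgm, hg⟩ := hs.exists_measurable_d2r
  have hm : Measurable fun q : ((Fin c → ℝ) × (Fin e → ℝ)) × ℝ =>
      (S.index d q.1.1 q.1.2, q.2) :=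
    ((S.measurable_index d).comp measurable_fst).prodMk measurable_snd
  have hset : MeasurableSet {q : ((Fin c → ℝ) × (Fin e → ℝ)) × ℝ | q.2 ∈ Ioo (0 : ℝ) 1 ∧
      g (S.index d q.1.1 q.1.2, q.2) =
        (![-1, 1] : Fin 2 → ℝ) d * S.condMean l d (S.index d q.1.1 q.1.2) q.2} :=
    (measurable_snd measurableSet_Ioo).inter (measurableSet_eq_fun (hgm.comp hm)
      (((S.measurable_condMean hl d).comp hm).const_mul _))
  have key : ∀ᵐ q ∂(S.μ.map fun ω => (S.X ω, S.V ω)), q.2 ∈ Ioo (0 : ℝ) 1 ∧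
      g (S.index d q.1.1 q.1.2, q.2) =
        (![-1, 1] : Fin 2 → ℝ) d * S.condMean l d (S.index d q.1.1 q.1.2) q.2 := by
    rw [h.map_XV, Measure.ae_prod_iff_ae_ae hset]
    refine Filter.Eventually.of_forall fun z => ?_
    have hI : ∀ᵐ v ∂(volume.restrict (Icc (0 : ℝ) 1)), v ∈ Ioo (0 : ℝ) 1 := by
      rw [← restrict_Ioo_eq_restrict_Icc]
      exact ae_restrict_mem measurableSet_Ioo
    filter_upwards [h.d2r_ae_eq hl d (S.index d z.1 z.2), hI] with v h1 h2
    exact ⟨h2, (hg _ v h2).trans h1⟩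
  filter_upwards [ae_of_ae_map S.measurable_XV.aemeasurable key] with ω hω
  exact (hg _ _ hω.1).symm.trans hω.2

theorem Admissible.mteRepresentation [NeZero c] [StandardBorelSpace Ω] (h : S.Admissible l)
    (hl : Measurable (Function.uncurry l)) : S.MTERepresentation l := by
  have hY := h.standing.integrable_Y
  refine (condExp_sub (hY 1) (hY 0) _).trans ?_
  filter_upwards [(h.condIndep 1).condExp_Ypot hl (hY 1), (h.condIndep 0).condExp_Ypot hl (hY 0),
    h.standing.d2r_index_ae_eq hl (h.nonLinear 1).1,
    h.standing.d2r_index_ae_eq hl (h.nonLinear 0).1] with ω h1 h0 h1' h0'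
  rw [Pi.sub_apply, h1, h0, mte, h1', h0']
  -- The sign `-1` for `d = 0` turns the sum of derivatives into the difference of conditional
  -- means.
  simp [sub_eq_add_neg]

end Model
end LimitedOutcome

theorem theoremA5 {c e : ℕ} [NeZero c]
    {Ω Ω' : Type*} [MeasurableSpace Ω] [StandardBorelSpace Ω]
    [MeasurableSpace Ω'] [StandardBorelSpace Ω']
    (l : ℝ → ℝ → ℝ) (hl : Measurable (Function.uncurry l))
    (S : LimitedOutcome.Model c e Ω) (S' : LimitedOutcome.Model c e Ω')
    (hS : S.Admissible l) (hS' : S'.Admissible l)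
    (hobs : S.obsLaw l = S'.obsLaw l) :
    -- the coefficients are identified
    (∀ d, S.γC d = S'.γC d ∧ S.γD d = S'.γD d) ∧
    -- the functions `r_d` are identified on the support of `(X'γ_d, P)`
    (∀ d, S.indexSupp d = S'.indexSupp d ∧
      ∀ t p, (t, p) ∈ S.indexSupp d → S.r l d t p = S'.r l d t p) ∧
    -- the marginal treatment effect is `∂₂r₁ + ∂₂r₀`
    (S.MTERepresentation l ∧ S'.MTERepresentation l) ∧
    -- and it is identified wherever the supports determine the derivatives
    (∀ xc xd, ∀ v ∈ Set.Ioo (0 : ℝ) 1,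
      (∀ d, AccPt v (Filter.principal {p | (S.index d xc xd, p) ∈ S.indexSupp d})) →
      S.mte l xc xd v = S'.mte l xc xd v) := by
  refine ⟨fun d => ⟨hS.γC_eq hS' hl hobs d, hS.γD_eq hS' hl hobs d⟩,
    fun d => ⟨hS.indexSupp_eq hS' hl hobs d, fun t p h => hS.r_eqOn_indexSupp hS' hl hobs h⟩,
    ⟨hS.mteRepresentation hl, hS'.mteRepresentation hl⟩, fun xc xd v hv hacc => ?_⟩
  rw [LimitedOutcome.Model.mte, LimitedOutcome.Model.mte, ← hS.index_eq hS' hl hobs 1,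
    ← hS.index_eq hS' hl hobs 0, hS.d2r_eq hS' hl hobs hv (hacc 1),
    hS.d2r_eq hS' hl hobs hv (hacc 0)]
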